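/- Let $n_1\le n_2\le n_3$ be positive integers and $N=n_1+n_2+n_3$. Let $C(n_1,n_2,n_3)$ denote the abstract simplicial complex with vertex set $\mathbb{Z}/N$ whose 1-simplices are all translates of $\{0,n_1\}$, $\{0,n_2\}$, $\{0,n_3\}$ and whose 2-simplices are all translates $x\mapsto x+t$ and inversions $x\mapsto t-x$ ($t\in\mathbb{Z}/N$) of $\{0,n_1,n_1+n_2\}$; write $C(n_1,n_2,n_3)$ also for its geometric realization. Call a space a cylinder if it is homeomorphic to $S^1\times[0,1]$, and a Möbius band if it is homeomorphic to the quotient of $[0,1]\times[0,1]$ obtained by identifying $(0,y)$ with $(1,1-y)$ for all $y\in[0,1]$. Theorem. Let $n,k\ge 1$ be integers with $\gcd(n,k)=1$. (a) Let $N=3n+k$ and assume $n+k\ne N/2$. Then $C(n,n,n+k)$ is a cylinder if $N$ is even, and a Möbius band if $N$ is odd. (b) Let $N=3n+2k$. Then $C(n,n+k,n+k)$ is a cylinder if $N$ is even, and a Möbius band if $N$ is odd. (Here $n+k\neq N/2$ holds automatically.) -/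

import Mathlib

namespace Tonnetz

/-- The geometric realization of an abstract simplicial complex `K` on a finite vertex set `V`:
the points of the standard simplex on `V` (barycentric coordinates) whose support is contained in
some simplex of `K`, as a subspace of `V → ℝ`. -/
def realization {V : Type*} [Fintype V] (K : AbstractSimplicialComplex V) : Set (V → ℝ) :=
  {x ∈ stdSimplex ℝ V | ∃ s ∈ K.faces, ∀ v, v ∉ s → x v = 0}

/-- The triad `{0, n₁, n₁ + n₂}` in `ℤ/N`, `N = n₁ + n₂ + n₃`. -/
def triad (n₁ n₂ n₃ : ℕ) : Finset (ZMod (n₁ + n₂ + n₃)) :=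
  {0, (n₁ : ZMod (n₁ + n₂ + n₃)), (n₁ : ZMod (n₁ + n₂ + n₃)) + (n₂ : ZMod (n₁ + n₂ + n₃))}

/-- The set of nonempty simplices of the generalized Tonnetz `C(n₁, n₂, n₃)`, with vertex set `ℤ/N`
for `N = n₁ + n₂ + n₃`: all singletons; all translates of `{0, n₁}`, `{0, n₂}`, `{0, n₃}`; and all
translates `x ↦ x + t` and inversions `x ↦ t - x` of `{0, n₁, n₁ + n₂}`. -/
def simplices (n₁ n₂ n₃ : ℕ) : Set (Finset (ZMod (n₁ + n₂ + n₃))) :=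
  {s | (∃ t, s = {t}) ∨
    (∃ t, s = {t, t + (n₁ : ZMod (n₁ + n₂ + n₃))} ∨ s = {t, t + (n₂ : ZMod (n₁ + n₂ + n₃))} ∨
      s = {t, t + (n₃ : ZMod (n₁ + n₂ + n₃))}) ∨
    (∃ t, s = (triad n₁ n₂ n₃).image (fun x => x + t) ∨
      s = (triad n₁ n₂ n₃).image (fun x => t - x))}

theorem subset_pair {α : Type*} [DecidableEq α] {s : Finset α} (hs : s.Nonempty) {a b : α}
    (h : s ⊆ {a, b}) : s = {a} ∨ s = {b} ∨ s = {a, b} := by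
  rw [Finset.subset_insert_iff] at h
  by_cases ha : a ∈ s
  · rcases Finset.subset_singleton_iff.1 h with h0 | h0
    · left
      rw [← Finset.insert_erase ha, h0]; rfl
    · right; right
      rw [← Finset.insert_erase ha, h0]
  · rw [Finset.erase_eq_of_notMem ha] at h
    right; left
    exact (Finset.subset_singleton_iff.1 h).resolve_left hs.ne_empty

theorem subset_triple {α : Type*} [DecidableEq α] {s : Finset α} (hs : s.Nonempty) {a b c : α}
    (h : s ⊆ {a, b, c}) : s = {a} ∨ s = {b} ∨ s = {c} ∨ s = {a, b} ∨ s = {b, c} ∨ s = {a, c} ∨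
      s = {a, b, c} := by
  rw [Finset.subset_insert_iff] at h
  by_cases ha : a ∈ s
  · rcases (s.erase a).eq_empty_or_nonempty with h0 | h0
    · left
      rw [← Finset.insert_erase ha, h0]; rfl
    · rw [← Finset.insert_erase ha]
      rcases subset_pair h0 h with h1 | h1 | h1 <;> rw [h1] <;> tauto
  · rw [Finset.erase_eq_of_notMem ha] at h
    rcases subset_pair hs h with h1 | h1 | h1 <;> tauto

theorem cast_add_eq_zero (n₁ n₂ n₃ : ℕ) :
    (n₁ : ZMod (n₁ + n₂ + n₃)) + n₂ + n₃ = 0 := by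
  have := ZMod.natCast_self (n₁ + n₂ + n₃)
  push_cast at this
  exact this

theorem singleton_mem_simplices (n₁ n₂ n₃ : ℕ) (t : ZMod (n₁ + n₂ + n₃)) :
    {t} ∈ simplices n₁ n₂ n₃ := Or.inl ⟨t, rfl⟩

theorem pair_mem_simplices (n₁ n₂ n₃ : ℕ) (a b : ZMod (n₁ + n₂ + n₃))
    (h : b - a = n₁ ∨ b - a = n₂ ∨ b - a = n₃ ∨ a - b = n₁ ∨ a - b = n₂ ∨ a - b = n₃) :
    {a, b} ∈ simplices n₁ n₂ n₃ := by
  right; left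
  rcases h with h | h | h | h | h | h
  · exact ⟨a, Or.inl (by rw [← h, add_sub_cancel])⟩
  · exact ⟨a, Or.inr (Or.inl (by rw [← h, add_sub_cancel]))⟩
  · exact ⟨a, Or.inr (Or.inr (by rw [← h, add_sub_cancel]))⟩
  · exact ⟨b, Or.inl (by rw [← h, add_sub_cancel, Finset.pair_comm])⟩
  · exact ⟨b, Or.inr (Or.inl (by rw [← h, add_sub_cancel, Finset.pair_comm]))⟩
  · exact ⟨b, Or.inr (Or.inr (by rw [← h, add_sub_cancel, Finset.pair_comm]))⟩

theorem isRelLowerSet_simplices (n₁ n₂ n₃ : ℕ) :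
    IsRelLowerSet (simplices n₁ n₂ n₃) Finset.Nonempty := by
  have hN := cast_add_eq_zero n₁ n₂ n₃
  intro s hs
  refine ⟨?_, ?_⟩
  · rcases hs with ⟨t, rfl⟩ | ⟨t, rfl | rfl | rfl⟩ | ⟨t, rfl | rfl⟩ <;> simp [triad]
  · intro r hrs hr
    rcases hs with ⟨t, rfl⟩ | ⟨t, hs⟩ | ⟨t, hs⟩
    · rw [(Finset.subset_singleton_iff.1 hrs).resolve_left hr.ne_empty]
      exact singleton_mem_simplices ..
    · have key : ∀ d : ZMod (n₁ + n₂ + n₃), (d = n₁ ∨ d = n₂ ∨ d = n₃) →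
          r ⊆ {t, t + d} → r ∈ simplices n₁ n₂ n₃ := by
        intro d hd hrd
        rcases subset_pair hr hrd with h | h | h <;> rw [h]
        · exact singleton_mem_simplices ..
        · exact singleton_mem_simplices ..
        · apply pair_mem_simplices
          rw [add_sub_cancel_left]
          tauto
      rcases hs with rfl | rfl | rfl
      · exact key _ (Or.inl rfl) hrs
      · exact key _ (Or.inr (Or.inl rfl)) hrs
      · exact key _ (Or.inr (Or.inr rfl)) hrs
    · rcases hs with hs | hs
      · have hrs' := hrs
        simp only [hs, triad, Finset.image_insert, Finset.image_singleton] at hrs'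
        rcases subset_triple hr hrs' with h | h | h | h | h | h | h
        · rw [h]; exact singleton_mem_simplices ..
        · rw [h]; exact singleton_mem_simplices ..
        · rw [h]; exact singleton_mem_simplices ..
        · rw [h]; apply pair_mem_simplices; left; ring
        · rw [h]; apply pair_mem_simplices; right; left; ring
        · rw [h]; apply pair_mem_simplices
          right; right; right; right; right
          linear_combination -hN
        · exact Or.inr (Or.inr ⟨t, Or.inl (by
            rw [h]; simp only [triad, Finset.image_insert, Finset.image_singleton])⟩)
      · have hrs' := hrs
        simp only [hs, triad, Finset.image_insert, Finset.image_singleton] at hrs'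
        rcases subset_triple hr hrs' with h | h | h | h | h | h | h
        · rw [h]; exact singleton_mem_simplices ..
        · rw [h]; exact singleton_mem_simplices ..
        · rw [h]; exact singleton_mem_simplices ..
        · rw [h]; apply pair_mem_simplices; right; right; right; left; ring
        · rw [h]; apply pair_mem_simplices; right; right; right; right; left; ring
        · rw [h]; apply pair_mem_simplices
          right; right; left
          linear_combination -hN
        · exact Or.inr (Or.inr ⟨t, Or.inr (by
            rw [h]; simp only [triad, Finset.image_insert, Finset.image_singleton])⟩)

/-- The generalized Tonnetz `C(n₁, n₂, n₃)` as an abstract simplicial complex on `ℤ/N`,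
`N = n₁ + n₂ + n₃`. -/
def complex (n₁ n₂ n₃ : ℕ) : AbstractSimplicialComplex (ZMod (n₁ + n₂ + n₃)) where
  faces := simplices n₁ n₂ n₃
  isRelLowerSet_faces := isRelLowerSet_simplices n₁ n₂ n₃
  singleton_mem := singleton_mem_simplices n₁ n₂ n₃

/-- The gluing of the vertical sides of the unit square by `(0, y) ∼ (1, 1 - y)`. -/
def mobiusGlue (p q : unitInterval × unitInterval) : Prop :=
  p.1 = 0 ∧ q.1 = 1 ∧ q.2 = unitInterval.symm p.2

/-- The Möbius band: the quotient space of the unit square by the equivalence relation generated by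
`(0, y) ∼ (1, 1 - y)`. -/
abbrev MobiusBand : Type := Quot mobiusGlue

/-- A topological space is a cylinder if it is homeomorphic to `S¹ × [0, 1]`. -/
def IsCylinder (X : Type*) [TopologicalSpace X] : Prop :=
  Nonempty (X ≃ₜ Circle × unitInterval)

/-- A topological space is a Möbius band if it is homeomorphic to the standard one. -/
def IsMobiusBand (X : Type*) [TopologicalSpace X] : Prop :=
  Nonempty (X ≃ₜ MobiusBand)

end Tonnetz

/-!
Put `u = n` in the first family and `u = n + k` in the second. By the relation `n₁ + n₂ + n₃ = 0` in
`ℤ/N`, every simplex is contained in a triangle of the complex, and the triangles are the sets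
`{t, t + u, t + 2 * u}` (`realization_eq_band_of_eq_left`, `realization_eq_band_of_eq_right`). As `gcd(n, k) = 1`, `u` is a unit of `ℤ/N`, and `N ≥ 5`.

The infinite complex with vertex set `ℤ` and triangles `{t, t + 1, t + 2}` triangulates the strip
`ℝ × [0, 1]`, the vertex `j` being placed at `(j, 0)` for `j` even and at `(j, 1)` for `j` odd.
Translation of the vertices by `N` acts on the strip as `(s, y) ↦ (s + N, y)` for `N` even and as
`(s, y) ↦ (s + N, 1 - y)` for `N` odd. So the quotient, which is the complex on `ℤ/N` because
`N ≥ 5` keeps neighbouring triangles apart, is a cylinder or a Möbius band.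

To make this precise without charts, let `K` be the compact set of triples `(t, b, c)` giving
barycentric coordinates `1 - b - c`, `b`, `c` in the `t`-th triangle, restricted to first strip
coordinate `t + b + 2 * c ∈ [0, N]` (`stripTriples`). Both the realization (`toBand`) and the unit
square (`toSquare`) are images of `K` under continuous surjections onto Hausdorff spaces, hence
topological quotients of `K`. By `bary_eq_iff`, two triples have the same image in the realization
exactly if their images in the square are glued by the translation above. The cylinder and the
Möbius band are the quotient of the square by the same gluing, so they are homeomorphic to the
realization (`nonempty_homeomorph_band`).
-/

namespace Tonnetz

/-- The `j`-th power of the reflection `y ↦ 1 - y` of the unit interval. -/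
noncomputable def flipBy (j : ℤ) (y : ℝ) : ℝ := if Even j then y else 1 - y

theorem flipBy_add (i j : ℤ) (y : ℝ) : flipBy (i + j) y = flipBy i (flipBy j y) := by
  unfold flipBy
  by_cases hi : Even i <;> by_cases hj : Even j <;> simp [Int.even_add, hi, hj]

theorem flipBy_flipBy (j : ℤ) (y : ℝ) : flipBy j (flipBy j y) = y := by
  unfold flipBy
  split_ifs <;> ring

theorem flipBy_mem_unitInterval (j : ℤ) {y : ℝ} (h : y ∈ unitInterval) :
    flipBy j y ∈ unitInterval := by
  unfold flipBy
  split_ifs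
  · exact h
  · exact ⟨by linarith [h.2], by linarith [h.1]⟩

/-! ### Barycentric coordinates in the triangles -/

section Bary

variable {N : ℕ}

/-- The point with barycentric coordinates `1 - b - c`, `b`, `c` in the triangle with vertices
`u * t`, `u * (t + 1)`, `u * (t + 2)`. -/
def bary (u : ZMod N) (t : ℤ) (b c : ℝ) : ZMod N → ℝ :=
  Pi.single (u * (t : ZMod N)) (1 - b - c) + Pi.single (u * ((t + 1 : ℤ) : ZMod N)) b +
    Pi.single (u * ((t + 2 : ℤ) : ZMod N)) c

theorem unit_mul_intCast_eq_iff {u : ZMod N} (hu : IsUnit u) (i j : ℤ) :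
    u * (i : ZMod N) = u * (j : ZMod N) ↔ (N : ℤ) ∣ j - i := by
  rw [hu.mul_right_inj, ZMod.intCast_eq_intCast_iff_dvd_sub]

theorem bary_add_mul (u : ZMod N) (t m : ℤ) (b c : ℝ) :
    bary u (t + m * N) b c = bary u t b c := by
  simp [bary]

/-- When `N ≥ 5`, a vertex at index distance at most two from the triangle coincides with one of its
vertices only if it does so before reduction modulo `N`. -/
theorem bary_apply {u : ZMod N} (hu : IsUnit u) (hN : 5 ≤ N) (t d : ℤ) (b c : ℝ)
    (h₁ : -2 ≤ d) (h₂ : d ≤ 4) :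
    bary u t b c (u * ((t + d : ℤ) : ZMod N)) =
      if d = 0 then 1 - b - c else if d = 1 then b else if d = 2 then c else 0 := by
  have key : ∀ i : ℤ, 0 ≤ i → i ≤ 2 →
      (u * ((t + d : ℤ) : ZMod N) = u * ((t + i : ℤ) : ZMod N) ↔ d = i) := by
    intro i hi₀ hi₂
    rw [unit_mul_intCast_eq_iff hu]
    constructor
    · intro h
      have := Int.eq_zero_of_abs_lt_dvd h (by rw [abs_lt]; omega)
      omega
    · rintro rfl
      simp
  have h0 := key 0 le_rfl (by norm_num)
  have h1 := key 1 (by norm_num) (by norm_num)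
  have h2 := key 2 (by norm_num) le_rfl
  rw [add_zero] at h0
  simp only [bary, Pi.add_apply, Pi.single_apply, h0, h1, h2]
  split_ifs <;> first | omega | simp

theorem exists_of_bary_ne_zero {u : ZMod N} {t : ℤ} {b c : ℝ} {v : ZMod N}
    (h : bary u t b c v ≠ 0) : ∃ i : ℤ, 0 ≤ i ∧ i ≤ 2 ∧ v = u * ((t + i : ℤ) : ZMod N) := by
  by_contra! H
  apply h
  have h0 := H 0 le_rfl (by norm_num)
  have h1 := H 1 (by norm_num) (by norm_num)
  have h2 := H 2 (by norm_num) le_rfl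
  rw [add_zero] at h0
  simp only [bary, Pi.add_apply, Pi.single_apply, h0, h1, h2, if_false, add_zero]

/-- Triangles with a common point have a common vertex. -/
theorem exists_shift_of_bary_eq {u : ZMod N} (hu : IsUnit u) (hN : 5 ≤ N) {t t' : ℤ}
    {b c b' c' : ℝ} (h : bary u t b c = bary u t' b' c') :
    ∃ d m : ℤ, -2 ≤ d ∧ d ≤ 2 ∧ t' = t + d + m * N := by
  obtain ⟨i, hi₀, hi₂, hi⟩ : ∃ i : ℤ, 0 ≤ i ∧ i ≤ 2 ∧
      bary u t b c (u * ((t + i : ℤ) : ZMod N)) ≠ 0 := by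
    by_contra! H
    have h0 := H 0 le_rfl (by norm_num)
    have h1 := H 1 (by norm_num) (by norm_num)
    have h2 := H 2 (by norm_num) le_rfl
    rw [bary_apply hu hN _ _ _ _ (by norm_num) (by norm_num)] at h0 h1 h2
    norm_num at h0 h1 h2
    linarith
  rw [h] at hi
  obtain ⟨i', hi₀', hi₂', h'⟩ := exists_of_bary_ne_zero hi
  rw [unit_mul_intCast_eq_iff hu] at h'
  obtain ⟨m, hm⟩ := h'
  exact ⟨i - i', m, by omega, by omega, by linarith⟩

/-- Two triples describe the same point of the strip `ℝ × [0, 1]` exactly if they give the same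
weights on the vertices in `ℤ`; the right-hand side lists the possible intersections of two
triangles: a common triangle, edge or vertex. -/
theorem overlap_iff {t d : ℤ} {b c b' c' : ℝ} (hb : 0 ≤ b) (hc : 0 ≤ c) (hbc : b + c ≤ 1)
    (hb' : 0 ≤ b') (hc' : 0 ≤ c') (hbc' : b' + c' ≤ 1) :
    ((t + d : ℤ) + b' + 2 * c' = t + b + 2 * c ∧ flipBy (t + d) b' = flipBy t b) ↔
      (d = 0 ∧ b' = b ∧ c' = c) ∨
      (d = 1 ∧ b + c = 1 ∧ b' = c ∧ c' = 0) ∨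
      (d = 2 ∧ c = 1 ∧ b = 0 ∧ b' = 0 ∧ c' = 0) ∨
      (d = -1 ∧ b' + c' = 1 ∧ b = c' ∧ c = 0) ∨
      (d = -2 ∧ c' = 1 ∧ b' = 0 ∧ b = 0 ∧ c = 0) := by
  have hflip : flipBy (t + d) b' = flipBy t b ↔ flipBy d b' = b := by
    rw [flipBy_add]
    constructor
    · intro h
      rw [← flipBy_flipBy t (flipBy d b'), h, flipBy_flipBy]
    · intro h
      rw [h]
  rw [hflip]
  push_cast
  constructor
  · rintro ⟨h₁, h₂⟩
    have hd₂ : (d : ℝ) ≤ 2 := by linarith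
    have hd₂' : (-2 : ℝ) ≤ d := by linarith
    have l₁ : d ≤ 2 := by exact_mod_cast hd₂
    have l₂ : -2 ≤ d := by exact_mod_cast hd₂'
    interval_cases d <;> norm_num [flipBy, Int.even_iff] at h₁ h₂ ⊢
    all_goals (repeat' apply And.intro) <;> linarith
  · rintro (⟨rfl, rfl, rfl⟩ | ⟨rfl, h₁, rfl, rfl⟩ | ⟨rfl, rfl, rfl, rfl, rfl⟩ |
      ⟨rfl, h₁, rfl, rfl⟩ | ⟨rfl, rfl, rfl, rfl, rfl⟩) <;> norm_num [flipBy, Int.even_iff] <;>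
      (try constructor) <;> linarith

/-- For triangles close to each other in `ℤ`, nothing is identified modulo `N ≥ 5` which is not
already the same point of the strip. -/
theorem bary_eq_bary_add_iff {u : ZMod N} (hu : IsUnit u) (hN : 5 ≤ N) {t d : ℤ}
    {b c b' c' : ℝ} (hd : -2 ≤ d) (hd' : d ≤ 2)
    (hb : 0 ≤ b) (hc : 0 ≤ c) (hbc : b + c ≤ 1) (hb' : 0 ≤ b') (hc' : 0 ≤ c')
    (hbc' : b' + c' ≤ 1) :
    bary u t b c = bary u (t + d) b' c' ↔
      ((t + d : ℤ) + b' + 2 * c' = t + b + 2 * c ∧ flipBy (t + d) b' = flipBy t b) := by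
  rw [overlap_iff hb hc hbc hb' hc' hbc']
  constructor
  · intro h
    have H : ∀ i : ℤ, -2 ≤ i → i ≤ 4 → -2 ≤ i - d → i - d ≤ 4 → _ := fun i h₁ h₂ h₃ h₄ => by
      have := congrFun h (u * ((t + i : ℤ) : ZMod N))
      rw [bary_apply hu hN _ _ _ _ h₁ h₂, show t + i = t + d + (i - d) by ring,
        bary_apply hu hN _ _ _ _ h₃ h₄] at this
      exact this
    have h0 := H 0 (by omega) (by omega) (by omega) (by omega)
    have h1 := H 1 (by omega) (by omega) (by omega) (by omega)
    have h2 := H 2 (by omega) (by omega) (by omega) (by omega)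
    have h3 := H d hd (by omega) (by omega) (by omega)
    have h4 := H (d + 1) (by omega) (by omega) (by omega) (by omega)
    have h5 := H (d + 2) (by omega) (by omega) (by omega) (by omega)
    clear H
    interval_cases d <;> norm_num at h0 h1 h2 h3 h4 h5 ⊢
    all_goals (repeat' apply And.intro) <;> linarith
  · rintro (⟨rfl, rfl, rfl⟩ | ⟨rfl, h₁, rfl, rfl⟩ | ⟨rfl, rfl, rfl, rfl, rfl⟩ |
      ⟨rfl, h₁, rfl, rfl⟩ | ⟨rfl, rfl, rfl, rfl, rfl⟩)
    · rw [add_zero]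
    · obtain rfl : b = 1 - b' := by linarith
      simp [bary, add_assoc]
    · simp [bary, add_assoc]
    · obtain rfl : b' = 1 - b := by linarith
      simp [bary, add_assoc]
    · simp [bary, add_assoc]

/-- Two triples give the same point of the complex exactly if their points in the strip
`ℝ × [0, 1]` differ by a power of the glide `(s, y) ↦ (s + N, flipBy N y)`. -/
theorem bary_eq_iff {u : ZMod N} (hu : IsUnit u) (hN : 5 ≤ N) {t t' : ℤ}
    {b c b' c' : ℝ} (hb : 0 ≤ b) (hc : 0 ≤ c) (hbc : b + c ≤ 1) (hb' : 0 ≤ b') (hc' : 0 ≤ c')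
    (hbc' : b' + c' ≤ 1) :
    bary u t b c = bary u t' b' c' ↔
      ∃ m : ℤ, t' + b' + 2 * c' = t + b + 2 * c + m * N ∧
        flipBy t' b' = flipBy (m * N) (flipBy t b) := by
  constructor
  · intro h
    obtain ⟨d, m, hd, hd', rfl⟩ := exists_shift_of_bary_eq hu hN h
    rw [bary_add_mul, bary_eq_bary_add_iff hu hN hd hd' hb hc hbc hb' hc' hbc'] at h
    refine ⟨m, ?_, ?_⟩
    · rw [← h.1]
      push_cast
      ring
    · rw [← h.2, ← flipBy_add, add_comm]
  · rintro ⟨m, h₁, h₂⟩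
    obtain ⟨d, rfl⟩ : ∃ d, t' = t + d + m * N := ⟨t' - t - m * N, by ring⟩
    rw [bary_add_mul]
    have h₃ : (t + d : ℤ) + b' + 2 * c' = t + b + 2 * c ∧ flipBy (t + d) b' = flipBy t b := by
      constructor
      · push_cast at h₁ ⊢
        linarith
      · rw [add_comm, flipBy_add] at h₂
        rw [← flipBy_flipBy (m * N) (flipBy (t + d) b'), h₂, flipBy_flipBy]
    have h₄ := (overlap_iff hb hc hbc hb' hc' hbc').1 h₃
    exact (bary_eq_bary_add_iff hu hN (by omega) (by omega) hb hc hbc hb' hc' hbc').2 h₃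

end Bary

/-! ### Triples as points of the unit square -/

/-- Two quotients of a space by the same equivalence relation are homeomorphic. -/
theorem nonempty_homeomorph_of_isQuotientMap {K Y Z : Type*} [TopologicalSpace K]
    [TopologicalSpace Y] [TopologicalSpace Z] {q : C(K, Y)} {g : C(K, Z)}
    (hq : Topology.IsQuotientMap q) (hg : Topology.IsQuotientMap g)
    (h : ∀ a b, q a = q b ↔ g a = g b) : Nonempty (Z ≃ₜ Y) := by
  have hk : Setoid.ker q = Setoid.ker g := by
    ext a b
    exact h a b
  have e := hq.homeomorph
  rw [hk] at e
  exact ⟨hg.homeomorph.symm.trans e⟩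

section Strip

/-- A triple `(t, b, c)` stands for the point with barycentric coordinates `1 - b - c`, `b`, `c` in
the `t`-th triangle of the strip `ℝ × [0, 1]`, triangulated with vertices `(j, 0)` for `j` even and
`(j, 1)` for `j` odd. Kept are the triples whose point has first coordinate in `[0, N]`; the bounds on `t`
follow from this. -/
def stripTriples (N : ℕ) : Set (ℤ × ℝ × ℝ) :=
  {p | -2 ≤ p.1 ∧ p.1 ≤ N ∧ 0 ≤ p.2.1 ∧ 0 ≤ p.2.2 ∧ p.2.1 + p.2.2 ≤ 1 ∧
    0 ≤ p.1 + p.2.1 + 2 * p.2.2 ∧ p.1 + p.2.1 + 2 * p.2.2 ≤ N}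

theorem continuous_comp_fst {X : Type*} [TopologicalSpace X] (f : ℤ → ℝ) {g : X → ℤ}
    (hg : Continuous g) : Continuous fun x => f (g x) :=
  continuous_of_discreteTopology.comp hg

theorem isCompact_stripTriples (N : ℕ) : IsCompact (stripTriples N) := by
  have h₁ : Continuous fun p : ℤ × ℝ × ℝ => (p.1 : ℝ) :=
    continuous_comp_fst (fun t => (t : ℝ)) continuous_fst
  have hI : IsCompact (Set.Icc ((-2, 0, 0) : ℤ × ℝ × ℝ) (N, 1, 1)) := isCompact_Icc
  refine hI.of_isClosed_subset ?_ ?_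
  · refine (isClosed_le (f := fun _ => (-2 : ℤ)) continuous_const continuous_fst).inter ?_
    refine (isClosed_le (g := fun _ => (N : ℤ)) continuous_fst continuous_const).inter ?_
    refine (isClosed_le (f := fun _ => (0 : ℝ)) (g := fun p : ℤ × ℝ × ℝ => p.2.1)
      (by fun_prop) (by fun_prop)).inter ?_
    refine (isClosed_le (f := fun _ => (0 : ℝ)) (g := fun p : ℤ × ℝ × ℝ => p.2.2)
      (by fun_prop) (by fun_prop)).inter ?_
    refine (isClosed_le (f := fun p : ℤ × ℝ × ℝ => p.2.1 + p.2.2) (g := fun _ => (1 : ℝ))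
      (by fun_prop) (by fun_prop)).inter ?_
    have h₂ : Continuous fun p : ℤ × ℝ × ℝ => p.1 + p.2.1 + 2 * p.2.2 := by fun_prop
    exact (isClosed_le (f := fun _ => (0 : ℝ)) continuous_const h₂).inter
      (isClosed_le (g := fun _ => (N : ℝ)) h₂ continuous_const)
  · rintro ⟨t, b, c⟩ ⟨h₁, h₂, h₃, h₄, h₅, -, -⟩
    exact ⟨⟨h₁, h₃, h₄⟩, ⟨h₂, by dsimp only at *; linarith, by dsimp only at *; linarith⟩⟩

instance (N : ℕ) : CompactSpace (stripTriples N) :=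
  isCompact_iff_compactSpace.1 (isCompact_stripTriples N)

/-- The point of `[0, N] × [0, 1]` described by a triple, with the first coordinate divided
by `N`. -/
noncomputable def toSquare (N : ℕ) [NeZero N] (p : stripTriples N) : unitInterval × unitInterval :=
  (⟨(p.1.1 + p.1.2.1 + 2 * p.1.2.2) / N, div_nonneg p.2.2.2.2.2.2.1 (Nat.cast_nonneg N),
    div_le_one_of_le₀ p.2.2.2.2.2.2.2 (Nat.cast_nonneg N)⟩,
  ⟨flipBy p.1.1 p.1.2.1, flipBy_mem_unitInterval _
    ⟨p.2.2.2.1, by linarith [p.2.2.2.2.1, p.2.2.2.2.2.1]⟩⟩)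

theorem continuous_toSquare (N : ℕ) [NeZero N] : Continuous (toSquare N) := by
  have h₀ : Continuous fun p : stripTriples N => p.1.1 := by fun_prop
  have h₁ : Continuous fun p : stripTriples N => (p.1.1 : ℝ) :=
    continuous_comp_fst (fun t => (t : ℝ)) h₀
  have h₂ := continuous_comp_fst (fun t => if Even t then (0 : ℝ) else 1) h₀
  have h₃ := continuous_comp_fst (fun t => if Even t then (1 : ℝ) else -1) h₀
  refine Continuous.prodMk (Continuous.subtype_mk (by fun_prop) _) (Continuous.subtype_mk ?_ _)
  have h₄ : (fun p : stripTriples N => flipBy p.1.1 p.1.2.1) = fun p =>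
      (if Even p.1.1 then (0 : ℝ) else 1) + (if Even p.1.1 then (1 : ℝ) else -1) * p.1.2.1 := by
    funext p
    unfold flipBy
    split_ifs <;> ring
  rw [h₄]
  fun_prop

/-- The triangles cover the strip. -/
theorem exists_triple (s y : ℝ) (hy : y ∈ unitInterval) :
    ∃ (t : ℤ) (b c : ℝ), 0 ≤ b ∧ 0 ≤ c ∧ b + c ≤ 1 ∧ t + b + 2 * c = s ∧ flipBy t b = y := by
  have hf₁ := Int.floor_le ((s - y) / 2)
  have hf₂ := Int.lt_floor_add_one ((s - y) / 2)
  set f := ⌊(s - y) / 2⌋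
  obtain ⟨hy₀, hy₁⟩ := hy
  -- `s - y - 2 * f ∈ [0, 2)` is the position between consecutive lattice points at height `y`;
  -- the edge between an odd and an even triangle cuts this segment at `2 * (1 - y)`.
  by_cases h : s - y - 2 * f ≤ 2 * (1 - y)
  · refine ⟨2 * f, y, (s - y - 2 * f) / 2, hy₀, by linarith, by linarith, ?_, ?_⟩
    · push_cast
      ring
    · simp [flipBy]
  · refine ⟨2 * f + 1, 1 - y, (s - y - 2 * f) / 2 - 1 + y, by linarith, by linarith, by linarith,
      ?_, ?_⟩
    · push_cast
      ring
    · simp [flipBy]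

theorem toSquare_surjective (N : ℕ) [NeZero N] : Function.Surjective (toSquare N) := by
  rintro ⟨⟨x, hx₀, hx₁⟩, ⟨y, hy⟩⟩
  have hN : (0 : ℝ) < N := by exact_mod_cast NeZero.pos N
  obtain ⟨t, b, c, hb, hc, hbc, hs, ht⟩ := exists_triple (N * x) y hy
  have h₀ : 0 ≤ N * x := mul_nonneg hN.le hx₀
  have h₁ : N * x ≤ N := mul_le_of_le_one_right hN.le hx₁
  have l₁ : ((-2 : ℤ) : ℝ) ≤ t := by push_cast; linarith
  have l₂ : (t : ℝ) ≤ ((N : ℤ) : ℝ) := by push_cast; linarith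
  refine ⟨⟨(t, b, c), Int.cast_le.1 l₁, Int.cast_le.1 l₂, hb, hc, hbc, by dsimp only; linarith,
    by dsimp only; linarith⟩, ?_⟩
  simp only [toSquare, hs, ht, mul_div_cancel_left₀ x hN.ne']

theorem isQuotientMap_toSquare (N : ℕ) [NeZero N] : Topology.IsQuotientMap (toSquare N) :=
  (continuous_toSquare N).isClosedMap.isQuotientMap (continuous_toSquare N) (toSquare_surjective N)

/-- The relation on the unit square which glues `(x, y)` and `(x + m, y')` for `m : ℤ`, where `y'`
is `y` or `1 - y` depending on the parity of `m * N`. -/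
def Glued (N : ℕ) (p q : unitInterval × unitInterval) : Prop :=
  ∃ m : ℤ, (q.1 : ℝ) = p.1 + m ∧ (q.2 : ℝ) = flipBy (m * N) p.2

theorem equivalence_glued (N : ℕ) : Equivalence (Glued N) where
  refl p := ⟨0, by simp, by simp [flipBy]⟩
  symm := by
    rintro p q ⟨m, h₁, h₂⟩
    refine ⟨-m, by rw [h₁]; push_cast; ring, ?_⟩
    rw [h₂, ← flipBy_add, neg_mul, neg_add_cancel]
    simp [flipBy]
  trans := by
    rintro p q r ⟨m, h₁, h₂⟩ ⟨m', h₁', h₂'⟩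
    refine ⟨m' + m, by rw [h₁', h₁]; push_cast; ring, ?_⟩
    rw [h₂', h₂, ← flipBy_add, add_mul]

theorem bary_eq_iff_glued {N : ℕ} [NeZero N] {u : ZMod N} (hu : IsUnit u) (hN : 5 ≤ N)
    (p q : stripTriples N) :
    bary u p.1.1 p.1.2.1 p.1.2.2 = bary u q.1.1 q.1.2.1 q.1.2.2 ↔
      Glued N (toSquare N p) (toSquare N q) := by
  obtain ⟨-, -, hb, hc, hbc, -, -⟩ := p.2
  obtain ⟨-, -, hb', hc', hbc', -, -⟩ := q.2
  have hN' : (N : ℝ) ≠ 0 := by exact_mod_cast NeZero.ne N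
  rw [bary_eq_iff hu hN hb hc hbc hb' hc' hbc', Glued]
  refine exists_congr fun m => and_congr ?_ Iff.rfl
  simp only [toSquare]
  rw [div_add' _ _ _ hN', div_left_inj' hN']

end Strip

/-! ### The band as a quotient of the unit square -/

section Realization

variable {N : ℕ} [NeZero N]

/-- The points of the standard simplex on `ZMod N` supported on one of the triangles
`{t, t + u, t + 2 * u}`. -/
def band (u : ZMod N) : Set (ZMod N → ℝ) :=
  {x ∈ stdSimplex ℝ (ZMod N) | ∃ t, ∀ v, v ≠ t → v ≠ t + u → v ≠ t + 2 * u → x v = 0}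

theorem bary_mem_band (u : ZMod N) {t : ℤ} {b c : ℝ} (hb : 0 ≤ b) (hc : 0 ≤ c)
    (hbc : b + c ≤ 1) : bary u t b c ∈ band u := by
  refine ⟨⟨fun v => ?_, ?_⟩, u * t, fun v h₀ h₁ h₂ => ?_⟩
  · have ha : 0 ≤ 1 - b - c := by linarith
    simp only [bary, Pi.add_apply, Pi.single_apply]
    refine add_nonneg (add_nonneg ?_ ?_) ?_ <;> split_ifs <;> first | assumption | exact le_rfl
  · simp only [bary, Pi.add_apply, Finset.sum_add_distrib, Finset.sum_pi_single', Finset.mem_univ,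
      if_true]
    ring
  · have e₁ : u * ((t + 1 : ℤ) : ZMod N) = u * t + u := by push_cast; ring
    have e₂ : u * ((t + 2 : ℤ) : ZMod N) = u * t + 2 * u := by push_cast; ring
    simp only [bary, e₁, e₂, Pi.add_apply, Pi.single_apply, h₀, h₁, h₂, if_false, add_zero]

/-- The point of the complex given by a triple. -/
def toBand (u : ZMod N) (p : stripTriples N) : band u :=
  ⟨bary u p.1.1 p.1.2.1 p.1.2.2, bary_mem_band u p.2.2.2.1 p.2.2.2.2.1 p.2.2.2.2.2.1⟩

theorem continuous_toBand (u : ZMod N) : Continuous (toBand u) := by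
  have h₀ : Continuous fun p : stripTriples N => p.1.1 := by fun_prop
  refine Continuous.subtype_mk (continuous_pi fun v => ?_) _
  have h₁ := continuous_comp_fst (fun t => if v = u * (t : ZMod N) then (1 : ℝ) else 0) h₀
  have h₂ := continuous_comp_fst
    (fun t => if v = u * ((t + 1 : ℤ) : ZMod N) then (1 : ℝ) else 0) h₀
  have h₃ := continuous_comp_fst
    (fun t => if v = u * ((t + 2 : ℤ) : ZMod N) then (1 : ℝ) else 0) h₀
  have h₄ : (fun p : stripTriples N => bary u p.1.1 p.1.2.1 p.1.2.2 v) = fun p =>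
      (if v = u * (p.1.1 : ZMod N) then (1 : ℝ) else 0) * (1 - p.1.2.1 - p.1.2.2) +
      (if v = u * ((p.1.1 + 1 : ℤ) : ZMod N) then (1 : ℝ) else 0) * p.1.2.1 +
      (if v = u * ((p.1.1 + 2 : ℤ) : ZMod N) then (1 : ℝ) else 0) * p.1.2.2 := by
    funext p
    simp only [bary, Pi.add_apply, Pi.single_apply, ite_mul, one_mul, zero_mul]
  rw [h₄]
  fun_prop

theorem toBand_surjective {u : ZMod N} (hu : IsUnit u) (hN : 5 ≤ N) :
    Function.Surjective (toBand u) := by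
  rintro ⟨x, ⟨hx₀, hx₁⟩, τ, hτ⟩
  obtain ⟨w, hw⟩ := hu.exists_right_inv
  set t : ℤ := ((w * τ).val : ℤ) with ht
  have hut : u * (t : ZMod N) = τ := by
    rw [ht, Int.cast_natCast, ZMod.natCast_zmod_val, ← mul_assoc, hw, one_mul]
  have e₁ : u * ((t + 1 : ℤ) : ZMod N) = τ + u := by push_cast; rw [mul_add, hut]; ring
  have e₂ : u * ((t + 2 : ℤ) : ZMod N) = τ + 2 * u := by push_cast; rw [mul_add, hut]; ring
  have hne : ∀ i j : ℤ, 0 ≤ i → i < j → j ≤ 2 →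
      u * ((t + i : ℤ) : ZMod N) ≠ u * ((t + j : ℤ) : ZMod N) := by
    intro i j hi hij hj h
    rw [unit_mul_intCast_eq_iff hu] at h
    have := Int.le_of_dvd (by omega) h
    omega
  have n₁ : τ ≠ τ + u := by
    simpa only [e₁, hut, add_zero] using hne 0 1 le_rfl (by norm_num) (by norm_num)
  have n₂ : τ ≠ τ + 2 * u := by
    simpa only [e₂, hut, add_zero] using hne 0 2 le_rfl (by norm_num) le_rfl
  have n₃ : τ + u ≠ τ + 2 * u := by
    simpa only [e₁, e₂] using hne 1 2 (by norm_num) (by norm_num) le_rfl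
  have hsum : x τ + x (τ + u) + x (τ + 2 * u) = 1 := by
    rw [← hx₁, ← Finset.sum_subset (Finset.subset_univ {τ, τ + u, τ + 2 * u})]
    · rw [Finset.sum_insert (by simp only [Finset.mem_insert, Finset.mem_singleton]; tauto),
        Finset.sum_pair n₃, add_assoc]
    · intro v _ hv
      simp only [Finset.mem_insert, Finset.mem_singleton, not_or] at hv
      exact hτ v hv.1 hv.2.1 hv.2.2
  set b := x (τ + u) with hb
  set c := x (τ + 2 * u) with hc
  have hx : bary u t b c = x := by
    funext v
    simp only [bary, e₁, e₂, hut, Pi.add_apply, Pi.single_apply]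
    by_cases h₀ : v = τ
    · subst h₀
      simp only [n₁, n₂, if_true, if_false, add_zero]
      linarith
    by_cases h₁ : v = τ + u
    · subst h₁
      simp only [n₁.symm, n₃, if_true, if_false, add_zero, zero_add]
      rfl
    by_cases h₂ : v = τ + 2 * u
    · subst h₂
      simp only [n₂.symm, n₃.symm, if_true, if_false, zero_add]
      rfl
    simp only [h₀, h₁, h₂, if_false, add_zero, hτ v h₀ h₁ h₂]
  have hb₀ : 0 ≤ b := hx₀ _
  have hc₀ : 0 ≤ c := hx₀ _
  have ha₀ := hx₀ τ
  have ht₀ : 0 ≤ t := by omega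
  have htN : t < N := by rw [ht]; exact_mod_cast ZMod.val_lt (w * τ)
  have ht₀' : (0 : ℝ) ≤ t := by exact_mod_cast ht₀
  have htN' : (t : ℝ) < N := by exact_mod_cast htN
  -- The triangles numbered `N - 2` and `N - 1` stick out of `[0, N]` on the right; such points are
  -- represented in the translate by `-N`.
  by_cases h : t + b + 2 * c ≤ N
  · refine ⟨⟨(t, b, c), ?_, htN.le, hb₀, hc₀, ?_, ?_, h⟩, Subtype.ext hx⟩ <;> dsimp only
    · omega
    · linarith
    · linarith
  · push Not at h
    have h₁ : (N : ℝ) < ((t + 2 : ℤ) : ℝ) := by push_cast; linarith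
    have h₂ : (N : ℤ) < t + 2 := by exact_mod_cast h₁
    refine ⟨⟨(t + (-1 : ℤ) * N, b, c), ?_, ?_, hb₀, hc₀, ?_, ?_, ?_⟩,
      Subtype.ext ((bary_add_mul u t (-1) b c).trans hx)⟩ <;> dsimp only
    · omega
    · omega
    · linarith
    · push_cast
      linarith
    · have h₃ : (5 : ℝ) ≤ N := by exact_mod_cast hN
      push_cast
      linarith

theorem isQuotientMap_toBand {u : ZMod N} (hu : IsUnit u) (hN : 5 ≤ N) :
    Topology.IsQuotientMap (toBand u) :=
  (continuous_toBand u).isClosedMap.isQuotientMap (continuous_toBand u) (toBand_surjective hu hN)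

/-- The band over `ZMod N` is homeomorphic to every quotient of the square by `Glued N`. -/
theorem nonempty_homeomorph_band {u : ZMod N} (hu : IsUnit u) (hN : 5 ≤ N) {Y : Type*}
    [TopologicalSpace Y] {q : unitInterval × unitInterval → Y} (hq : Topology.IsQuotientMap q)
    (h : ∀ p p', q p = q p' ↔ Glued N p p') : Nonempty (band u ≃ₜ Y) := by
  refine nonempty_homeomorph_of_isQuotientMap
    (q := ⟨q ∘ toSquare N, hq.continuous.comp (continuous_toSquare N)⟩)
    (g := ⟨toBand u, continuous_toBand u⟩) (hq.comp (isQuotientMap_toSquare N))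
    (isQuotientMap_toBand hu hN) fun p p' => ?_
  refine (h _ _).trans ?_
  rw [← bary_eq_iff_glued hu hN]
  exact (Subtype.ext_iff (a1 := toBand u p) (a2 := toBand u p')).symm

theorem isCylinder_band {u : ZMod N} (hu : IsUnit u) (hN : 5 ≤ N) (he : Even N) :
    IsCylinder (band u) := by
  let q : unitInterval × unitInterval → Circle × unitInterval :=
    fun p => (Circle.exp (p.1 * (2 * Real.pi)), p.2)
  have hqc : Continuous q := by fun_prop
  have hqs : Function.Surjective q := by
    rintro ⟨z, y⟩
    obtain ⟨θ, rfl⟩ := Circle.exp_surjective z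
    refine ⟨(⟨Int.fract (θ / (2 * Real.pi)), Int.fract_nonneg _, (Int.fract_lt_one _).le⟩, y), ?_⟩
    refine Prod.ext (Circle.exp_eq_exp.2 ⟨-⌊θ / (2 * Real.pi)⌋, ?_⟩) rfl
    have := Real.two_pi_pos.ne'
    simp only [Int.fract]
    push_cast
    field_simp
    ring
  refine nonempty_homeomorph_band hu hN (hqc.isClosedMap.isQuotientMap hqc hqs)
    fun p p' => ?_
  have hflip : ∀ (m : ℤ) (y : ℝ), flipBy (m * N) y = y := fun m y =>
    if_pos (((Int.even_coe_nat N).2 he).mul_left m)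
  simp only [q, Glued, hflip, Prod.ext_iff, Subtype.ext_iff (a1 := p.2)]
  rw [eq_comm, Circle.exp_eq_exp, eq_comm (a := (p.2 : ℝ)), exists_and_right]
  refine and_congr (exists_congr fun m => ?_) Iff.rfl
  rw [← add_mul, mul_left_inj' Real.two_pi_pos.ne']

theorem isMobiusBand_band {u : ZMod N} (hu : IsUnit u) (hN : 5 ≤ N) (ho : Odd N) :
    IsMobiusBand (band u) := by
  have hN' : ¬ Even (N : ℤ) := by rwa [Int.even_coe_nat, Nat.not_even_iff_odd]
  refine nonempty_homeomorph_band hu hN (q := Quot.mk mobiusGlue) isQuotientMap_quot_mk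
    fun p p' => ⟨fun h => ?_, ?_⟩
  · have hs : ∀ a b, mobiusGlue a b → Glued N a b := by
      rintro a b ⟨h₁, h₂, h₃⟩
      refine ⟨1, by simp [h₁, h₂], by simp [h₃, flipBy, hN']⟩
    exact (equivalence_glued N).eqvGen_iff.1 (Relation.EqvGen.mono hs _ _ (Quot.eqvGen_exact h))
  · rintro ⟨m, h₁, h₂⟩
    have l₁ : ((-1 : ℤ) : ℝ) ≤ m := by push_cast; linarith [p.1.2.2, p'.1.2.1]
    have l₂ : (m : ℝ) ≤ (1 : ℤ) := by push_cast; linarith [p.1.2.1, p'.1.2.2]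
    have l₃ : -1 ≤ m := Int.cast_le.1 l₁
    have l₄ : m ≤ 1 := Int.cast_le.1 l₂
    interval_cases m
    · refine (Quot.sound ⟨Subtype.ext ?_, Subtype.ext ?_, Subtype.ext ?_⟩).symm
      · push_cast at h₁ ⊢
        linarith [p.1.2.2, p'.1.2.1]
      · push_cast at h₁ ⊢
        linarith [p.1.2.2, p'.1.2.1]
      · simp [flipBy, hN'] at h₂ ⊢
        linarith
    · refine congrArg _ (Prod.ext (Subtype.ext ?_) (Subtype.ext ?_))
      · simpa using h₁.symm
      · simpa [flipBy] using h₂.symm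
    · refine Quot.sound ⟨Subtype.ext ?_, Subtype.ext ?_, Subtype.ext ?_⟩
      · push_cast at h₁ ⊢
        linarith [p.1.2.1, p'.1.2.2]
      · push_cast at h₁ ⊢
        linarith [p.1.2.1, p'.1.2.2]
      · simpa [flipBy, hN'] using h₂

/-! ### The Tonnetz as a band -/

theorem realization_eq_band {n₁ n₂ n₃ : ℕ} [NeZero (n₁ + n₂ + n₃)] {u : ZMod (n₁ + n₂ + n₃)}
    (h₁ : ∀ s ∈ simplices n₁ n₂ n₃, ∃ t, s ⊆ {t, t + u, t + 2 * u})
    (h₂ : ∀ t, {t, t + u, t + 2 * u} ∈ simplices n₁ n₂ n₃) :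
    realization (complex n₁ n₂ n₃) = band u := by
  ext x
  refine and_congr Iff.rfl ⟨?_, ?_⟩
  · rintro ⟨s, hs, hx⟩
    obtain ⟨t, ht⟩ := h₁ s hs
    refine ⟨t, fun v v₀ v₁ v₂ => hx v fun hv => ?_⟩
    simpa [v₀, v₁, v₂] using ht hv
  · rintro ⟨t, hx⟩
    refine ⟨_, h₂ t, fun v hv => ?_⟩
    simp only [Finset.mem_insert, Finset.mem_singleton, not_or] at hv
    exact hx v hv.1 hv.2.1 hv.2.2

theorem triad_image_add (n₁ n₂ n₃ : ℕ) (t : ZMod (n₁ + n₂ + n₃)) :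
    (triad n₁ n₂ n₃).image (fun x => x + t) = {t, n₁ + t, n₁ + n₂ + t} := by
  simp only [triad, Finset.image_insert, Finset.image_singleton, zero_add]

theorem triad_image_sub (n₁ n₂ n₃ : ℕ) (t : ZMod (n₁ + n₂ + n₃)) :
    (triad n₁ n₂ n₃).image (fun x => t - x) = {t, t - n₁, t - (n₁ + n₂)} := by
  simp only [triad, Finset.image_insert, Finset.image_singleton, sub_zero]

theorem triple_subset {α : Type*} [DecidableEq α] {a b c : α} {s : Finset α} (ha : a ∈ s)
    (hb : b ∈ s) (hc : c ∈ s) : ({a, b, c} : Finset α) ⊆ s := by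
  simp only [Finset.insert_subset_iff, Finset.singleton_subset_iff]
  exact ⟨ha, hb, hc⟩

theorem realization_eq_band_of_eq_left (n m : ℕ) [NeZero (n + n + m)] :
    realization (complex n n m) = band (n : ZMod (n + n + m)) := by
  have h := cast_add_eq_zero n n m
  have hm : (m : ZMod (n + n + m)) = -2 * n := by linear_combination h
  refine realization_eq_band ?_ fun t => ?_
  · rintro s (⟨t, rfl⟩ | ⟨t, rfl | rfl | rfl⟩ | ⟨t, rfl | rfl⟩)
    · exact ⟨t, by simp⟩
    · exact ⟨t, by simp [Finset.insert_subset_iff]⟩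
    · exact ⟨t, by simp [Finset.insert_subset_iff]⟩
    · refine ⟨t - 2 * n, ?_⟩
      simp [Finset.insert_subset_iff, hm, sub_eq_add_neg]
    · rw [triad_image_add]
      refine ⟨t, triple_subset ?_ ?_ ?_⟩ <;> simp only [Finset.mem_insert, Finset.mem_singleton]
      · exact Or.inl trivial
      · exact Or.inr (Or.inl (by ring))
      · exact Or.inr (Or.inr (by ring))
    · rw [triad_image_sub]
      refine ⟨t - 2 * n, triple_subset ?_ ?_ ?_⟩ <;>
        simp only [Finset.mem_insert, Finset.mem_singleton]
      · exact Or.inr (Or.inr (by ring))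
      · exact Or.inr (Or.inl (by ring))
      · exact Or.inl (by ring)
  · right; right
    refine ⟨t, Or.inl ?_⟩
    rw [triad_image_add, add_comm t, add_comm t, two_mul]

theorem realization_eq_band_of_eq_right (n m : ℕ) [NeZero (n + m + m)] :
    realization (complex n m m) = band (m : ZMod (n + m + m)) := by
  have h := cast_add_eq_zero n m m
  have hn : (n : ZMod (n + m + m)) = -2 * m := by linear_combination h
  refine realization_eq_band ?_ fun t => ?_
  · rintro s (⟨t, rfl⟩ | ⟨t, rfl | rfl | rfl⟩ | ⟨t, rfl | rfl⟩)
    · exact ⟨t, by simp⟩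
    · refine ⟨t - 2 * m, ?_⟩
      simp [Finset.insert_subset_iff, hn, sub_eq_add_neg]
    · exact ⟨t, by simp [Finset.insert_subset_iff]⟩
    · exact ⟨t, by simp [Finset.insert_subset_iff]⟩
    · rw [triad_image_add, hn]
      refine ⟨t - 2 * m, triple_subset ?_ ?_ ?_⟩ <;>
        simp only [Finset.mem_insert, Finset.mem_singleton]
      · exact Or.inr (Or.inr (by ring))
      · exact Or.inl (by ring)
      · exact Or.inr (Or.inl (by ring))
    · rw [triad_image_sub, hn]
      refine ⟨t, triple_subset ?_ ?_ ?_⟩ <;> simp only [Finset.mem_insert, Finset.mem_singleton]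
      · exact Or.inl trivial
      · exact Or.inr (Or.inr (by ring))
      · exact Or.inr (Or.inl (by ring))
  · right; right
    refine ⟨t, Or.inr ?_⟩
    rw [triad_image_sub, hn, Finset.pair_comm]
    congr 3 <;> ring

end Realization

end Tonnetz

theorem mainTheorem3 (n k : ℕ) [NeZero n] [NeZero k] (hgcd : Nat.gcd n k = 1) :
    (2 * (n + k) ≠ n + n + (n + k) →
      (Even (n + n + (n + k)) →
        Tonnetz.IsCylinder (Tonnetz.realization (Tonnetz.complex n n (n + k)))) ∧
      (Odd (n + n + (n + k)) →
        Tonnetz.IsMobiusBand (Tonnetz.realization (Tonnetz.complex n n (n + k))))) ∧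
    (Even (n + (n + k) + (n + k)) →
      Tonnetz.IsCylinder (Tonnetz.realization (Tonnetz.complex n (n + k) (n + k)))) ∧
    (Odd (n + (n + k) + (n + k)) →
      Tonnetz.IsMobiusBand (Tonnetz.realization (Tonnetz.complex n (n + k) (n + k)))) := by
  -- `N ≥ 5` in all cases: the excluded `2 * (n + k) = N` amounts to `n = k = 1`, where `N = 4`.
  have hk := NeZero.pos k
  have hn := NeZero.pos n
  have hu₁ : IsUnit (n : ZMod (n + n + (n + k))) := by
    rw [ZMod.isUnit_iff_coprime, show n + n + (n + k) = k + 3 * n by ring,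
      Nat.coprime_add_mul_right_right]
    exact hgcd
  have hu₂ : IsUnit ((n + k : ℕ) : ZMod (n + (n + k) + (n + k))) := by
    rw [ZMod.isUnit_iff_coprime, Nat.coprime_add_self_right, Nat.coprime_add_self_right,
      Nat.coprime_comm, Nat.coprime_self_add_right]
    exact hgcd
  rw [Tonnetz.realization_eq_band_of_eq_left, Tonnetz.realization_eq_band_of_eq_right]
  refine ⟨fun h => ⟨Tonnetz.isCylinder_band hu₁ ?_, Tonnetz.isMobiusBand_band hu₁ ?_⟩,
    Tonnetz.isCylinder_band hu₂ (by omega), Tonnetz.isMobiusBand_band hu₂ (by omega)⟩ <;> omega
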